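/- Fix $n\ge 1$. Let $Q_n$ be the quiver with vertices $1,\dots,n$, a loop $a_{2v-1}$ at each vertex $v$, and arrows $a_{2v}\colon v\to v+1$, $b_{2v}\colon v+1\to v$ for $1\le v<n$; let $b_{2v-1}$ be the trivial path at $v$, and put $\mathsf{x}_i=a_ib_i$, $\mathsf{x}_i'=b_ia_i$ for $1\le i\le 2n-1$ (paths composed from left to right). Let $\mathsf{M}$ be the space of all families $k=(k_{ij})_{1\le i\le 2n-1,\ j\ge 2}$ of complex numbers, and for $k\in\mathsf{M}$ let $$f(k)=\sum_{i=1}^{2n-2}\mathsf{x}_i'\mathsf{x}_{i+1}+\sum_{i=1}^{2n-1}\sum_{j\ge 2}k_{ij}\mathsf{x}_i^{\,j}$$ be the corresponding monomialised Type $A$ potential on $Q_n$. For $0\le r\le 2n-1$ let $g_0,\dots,g_{2n}\in(x,y)\subset\mathbb{C}[[x,y]]$ be the solution of $$g_{i-1}+\sum_{j\ge 2}j\,k_{ij}\,g_i^{\,j-1}+g_{i+1}=0\qquad(1\le i\le 2n-1)$$ with $g_r=y$ and $g_{r+1}=x$. For $1\le s\le t\le n$ the generalised Gopakumar--Vafa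 invariant is $$N_{st}(f(k))=\dim_{\mathbb{C}}\mathbb{C}[[x,y]]/(g_{2s-2},g_{2t})\in\mathbb{N}\cup\{\infty\},$$ where any choice of $r$ may be used. For $1\le i\le j\le 2n-1$ let $A^2_{ij}(f(k))$ be the tridiagonal matrix of size $j-i+1$ with diagonal entries $2k_{i2},2k_{i+1,2},\dots,2k_{j2}$ and all entries directly above and below the diagonal equal to $1$. Fix $s,t$ with $1\le s\le t\le n$. Then $\mathsf{M}$ admits a strictly decreasing filtration $\mathsf{M}=M_1\supsetneq M_2\supsetneq M_3\supsetneq\cdots$ such that: 1. For each $i\ge 1$ and every choice of $r$, one has $N_{st}(f(k))=i$ for all $k\in M_i\setminus M_{i+1}$. 2. Each $M_i$ is the common zero locus in $\mathsf{M}$ of finitely many power series, in fact of finitely many polynomials, in the coordinates $\kappa_{ij}$ of $\mathsf{M}$. Moreover, $M_2=\{k\in\mathsf{M}\mid \det A^2_{2s-1,2t-1}(f(k))=0\}$. 3. If $s=t$, then $M_i=\{k\in\mathsf{M}\mid k_{2s-1,j}=0\text{ for }2\le j\le i\}$ for each $i\ge 2$. -/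

import Mathlib

namespace TypeA

/-! The quiver `Q_n`: the double of the linear `A_n` quiver with a loop at every vertex.
The vertices `1, …, n` are represented by `Fin n`, so `v : Fin n` is the vertex `v + 1`. -/

/-- The arrows of `Q_n`, from tail to head: `loop v` is `a_{2v+1}`, `fwd v w` is `a_{2v+2}`
from `v` to `w = v + 1`, and `bwd w v` is `b_{2v+2}` from `w = v + 1` to `v`. -/
inductive Arrow (n : ℕ) : Fin n → Fin n → Type
  | loop (v : Fin n) : Arrow n v v
  | fwd (v w : Fin n) (h : w.val = v.val + 1) : Arrow n v w
  | bwd (w v : Fin n) (h : w.val = v.val + 1) : Arrow n w v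

instance quiverQ (n : ℕ) : Quiver (Fin n) := ⟨Arrow n⟩

/-- The arrow of `Q_n` as a path of length one. -/
def arrowPath {n : ℕ} {v w : Fin n} (a : Arrow n v w) : Quiver.Path v w :=
  Quiver.Path.cons Quiver.Path.nil a

/-- The vertex at which the cyclic path `x_i` is based. -/
def baseX (n i : ℕ) (h1 : 1 ≤ i) (h2 : i < 2 * n) : Fin n := ⟨(i - 1) / 2, by omega⟩

/-- The vertex at which the cyclic path `x_i'` is based. -/
def baseX' (n i : ℕ) (h2 : i < 2 * n) : Fin n := ⟨i / 2, by omega⟩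

/-- The cyclic path `x_i = a_i b_i`, where `b_i` is a trivial path when `i` is odd
(paths are composed from left to right). -/
def pathX (n i : ℕ) (h1 : 1 ≤ i) (h2 : i < 2 * n) :
    Quiver.Path (baseX n i h1 h2) (baseX n i h1 h2) :=
  if hi : i % 2 = 1 then arrowPath (Arrow.loop _)
  else
    (arrowPath (Arrow.fwd (baseX n i h1 h2) (baseX' n i h2)
      (by simp only [baseX, baseX']; omega))).comp
    (arrowPath (Arrow.bwd (baseX' n i h2) (baseX n i h1 h2)
      (by simp only [baseX, baseX']; omega)))

/-- The cyclic path `x_i' = b_i a_i`. -/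
def pathX' (n i : ℕ) (h1 : 1 ≤ i) (h2 : i < 2 * n) :
    Quiver.Path (baseX' n i h2) (baseX' n i h2) :=
  if hi : i % 2 = 1 then arrowPath (Arrow.loop _)
  else
    (arrowPath (Arrow.bwd (baseX' n i h2) (baseX n i h1 h2)
      (by simp only [baseX, baseX']; omega))).comp
    (arrowPath (Arrow.fwd (baseX n i h1 h2) (baseX' n i h2)
      (by simp only [baseX, baseX']; omega)))

/-- The `j`-th power of a cyclic path. -/
def pathPow {n : ℕ} {v : Fin n} (p : Quiver.Path v v) : ℕ → Quiver.Path v v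
  | 0 => Quiver.Path.nil
  | j + 1 => (pathPow p j).comp p

/-- Cyclic paths of `Q_n`. -/
abbrev Cycle (n : ℕ) : Type := Σ v : Fin n, Quiver.Path v v

/-- Potentials on `Q_n`: possibly infinite complex linear combinations of cyclic paths,
given by their coefficients. -/
abbrev Potential (n : ℕ) : Type := Cycle n → ℂ

/-- The cyclic path `x_i ^ j`. -/
def cycleXPow (n i j : ℕ) (h1 : 1 ≤ i) (h2 : i < 2 * n) : Cycle n :=
  ⟨baseX n i h1 h2, pathPow (pathX n i h1 h2) j⟩

/-- The cyclic path `x_i' x_{i+1}`. -/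
def cycleMixed (n i : ℕ) (h1 : 1 ≤ i) (h2 : i + 1 < 2 * n) : Cycle n :=
  ⟨baseX' n i (by omega),
    (pathX' n i h1 (by omega)).comp (pathX n (i + 1) (by omega) h2)⟩

/-- Indices `(i, j)` of the parameters: `1 ≤ i ≤ 2n - 1` and `j ≥ 2`. -/
abbrev ParamIndex (n : ℕ) : Type := {p : ℕ × ℕ // 1 ≤ p.1 ∧ p.1 < 2 * n ∧ 2 ≤ p.2}

/-- The parameter space `M` of all families `k = (k_{ij})` of complex numbers. -/
abbrev ParamSpace (n : ℕ) : Type := ParamIndex n → ℂ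

open Classical in
/-- The monomialised Type `A` potential
`f(k) = ∑_{i=1}^{2n-2} x_i' x_{i+1} + ∑_{i=1}^{2n-1} ∑_{j ≥ 2} k_{ij} x_i ^ j`.
(In the second sum at most one summand contributes to a given cyclic path.) -/
noncomputable def potential (n : ℕ) (k : ParamSpace n) : Potential n := fun c =>
  (∑ i : Fin (2 * n - 2),
    if c = cycleMixed n (i.val + 1) (by omega) (by omega) then (1 : ℂ) else 0) +
  ∑ᶠ p : ParamIndex n, if c = cycleXPow n p.1.1 p.1.2 p.2.1 p.2.2.1 then k p else 0

/-- The family of coefficients of the `x_i ^ j` in a potential. -/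
def potentialCoeffs {n : ℕ} (f : Potential n) : ParamSpace n := fun p =>
  f (cycleXPow n p.1.1 p.1.2 p.2.1 p.2.2.1)

/-! The coefficients of `f(k)` are the `k_{ij}`. To tell cyclic paths apart, count arrows. -/

/-- Is the arrow equal to `a_m`? -/
def arrowIsA {n : ℕ} (m : ℕ) : {v w : Fin n} → Arrow n v w → ℕ
  | _, _, .loop v => if 2 * v.val + 1 = m then 1 else 0
  | _, _, .fwd v _ _ => if 2 * v.val + 2 = m then 1 else 0
  | _, _, .bwd _ _ _ => 0

/-- The number of times the arrow `a_m` occurs in a path. -/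
def countA {n : ℕ} (m : ℕ) {u : Fin n} : {v : Fin n} → Quiver.Path u v → ℕ
  | _, .nil => 0
  | _, .cons p a => countA m p + arrowIsA m a

theorem countA_comp {n : ℕ} (m : ℕ) {u v w : Fin n} (p : Quiver.Path u v)
    (q : Quiver.Path v w) : countA m (p.comp q) = countA m p + countA m q := by
  induction q with
  | nil => simp [countA]
  | cons q a ih => simp [countA, ih, add_assoc]

theorem countA_pathX {n i : ℕ} (m : ℕ) (h1 : 1 ≤ i) (h2 : i < 2 * n) :
    countA m (pathX n i h1 h2) = if i = m then 1 else 0 := by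
  unfold pathX
  split_ifs with h h' h' <;>
    simp only [arrowPath, countA_comp, countA, arrowIsA, baseX, zero_add, add_zero] <;>
    split_ifs <;> omega

theorem countA_pathX' {n i : ℕ} (m : ℕ) (h1 : 1 ≤ i) (h2 : i < 2 * n) :
    countA m (pathX' n i h1 h2) = if i = m then 1 else 0 := by
  unfold pathX'
  split_ifs with h h' h' <;>
    simp only [arrowPath, countA_comp, countA, arrowIsA, baseX, baseX', zero_add, add_zero] <;>
    split_ifs <;> omega

theorem countA_pathPow {n : ℕ} (m : ℕ) {v : Fin n} (p : Quiver.Path v v) (j : ℕ) :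
    countA m (pathPow p j) = j * countA m p := by
  induction j with
  | zero => simp [pathPow, countA]
  | succ j ih => simp [pathPow, countA_comp, ih, add_mul]

theorem cycleXPow_ne_cycleMixed {n i j m : ℕ} (h1 : 1 ≤ i) (h2 : i < 2 * n)
    (h3 : 1 ≤ m) (h4 : m + 1 < 2 * n) :
    cycleXPow n i j h1 h2 ≠ cycleMixed n m h3 h4 := by
  intro h
  have e : ∀ l, countA l (cycleXPow n i j h1 h2).2 = countA l (cycleMixed n m h3 h4).2 :=
    fun l => by rw [h]
  have e1 : ∀ l, j * (if i = l then 1 else 0)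
      = (if m = l then 1 else 0) + (if m + 1 = l then 1 else 0) := by
    intro l
    have := e l
    simp only [cycleXPow, cycleMixed] at this
    erw [countA_pathPow, countA_comp, countA_pathX, countA_pathX', countA_pathX] at this
    exact this
  have ea := e1 m
  have eb := e1 (m + 1)
  by_cases hm : i = m
  · subst hm; simp at eb
  · simp [hm] at ea

theorem cycleXPow_injective {n i j i' j' : ℕ} (h1 : 1 ≤ i) (h2 : i < 2 * n)
    (h1' : 1 ≤ i') (h2' : i' < 2 * n) (hj : 2 ≤ j)
    (h : cycleXPow n i j h1 h2 = cycleXPow n i' j' h1' h2') : i' = i ∧ j' = j := by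
  have e : countA i (cycleXPow n i j h1 h2).2 = countA i (cycleXPow n i' j' h1' h2').2 := by
    rw [h]
  simp only [cycleXPow, countA_pathPow, countA_pathX] at e
  by_cases hi : i' = i
  · subst hi; simp at e; exact ⟨rfl, e.symm⟩
  · simp [hi] at e; omega

/-- The coefficient of `x_i ^ j` in `f(k)` is `k_{ij}`. -/
theorem potentialCoeffs_potential (n : ℕ) (k : ParamSpace n) :
    potentialCoeffs (potential n k) = k := by
  classical
  funext p
  unfold potentialCoeffs potential
  rw [Finset.sum_eq_zero, zero_add, finsum_eq_single _ p]
  · simp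
  · intro q hq
    rw [if_neg]
    intro h
    obtain ⟨ha, hb⟩ := cycleXPow_injective p.2.1 p.2.2.1 q.2.1 q.2.2.1 p.2.2.2 h
    exact hq (Subtype.ext (Prod.ext ha hb))
  · intro i _
    rw [if_neg (cycleXPow_ne_cycleMixed _ _ _ _)]

/-! The generalised Gopakumar--Vafa invariants. -/

/-- The parameter `k_{ij}`, with value `0` outside the range of indices. -/
noncomputable def par {n : ℕ} (k : ParamSpace n) (i j : ℕ) : ℂ :=
  if h : 1 ≤ i ∧ i < 2 * n ∧ 2 ≤ j then k ⟨(i, j), h⟩ else 0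

/-- The one-variable power series `∑_{j ≥ 2} j k_{ij} z ^ (j - 1)`. -/
noncomputable def derivSeries {n : ℕ} (k : ParamSpace n) (i : ℕ) : PowerSeries ℂ :=
  PowerSeries.mk fun m => ((m : ℂ) + 1) * par k i (m + 1)

/-- The power series ring `ℂ⟦x, y⟧`, with `x = X 0` and `y = X 1`. -/
abbrev Rxy : Type := MvPowerSeries (Fin 2) ℂ

/-- `g_0, …, g_{2n}` in the ideal `(x, y)` of `ℂ⟦x, y⟧` solve the system
`g_{i-1} + ∑_{j ≥ 2} j k_{ij} g_i ^ (j-1) + g_{i+1} = 0` for `1 ≤ i ≤ 2n - 1`,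
with `g_r = y` and `g_{r+1} = x`. Entries of `g` beyond `2n` are irrelevant. -/
structure IsSolution {n : ℕ} (k : ParamSpace n) (r : ℕ) (g : ℕ → Rxy) : Prop where
  base_y : g r = MvPowerSeries.X 1
  base_x : g (r + 1) = MvPowerSeries.X 0
  mem : ∀ i, i ≤ 2 * n → g i ∈ Ideal.span {(MvPowerSeries.X 0 : Rxy), MvPowerSeries.X 1}
  eqn : ∀ i, 1 ≤ i → i < 2 * n →
    g (i - 1) + PowerSeries.subst (g i) (derivSeries k i) + g (i + 1) = 0

/-- The ideal `(x, y)` consists of the power series without constant term. -/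
theorem mem_span_iff (g : Rxy) :
    g ∈ Ideal.span {(MvPowerSeries.X 0 : Rxy), MvPowerSeries.X 1} ↔
      MvPowerSeries.constantCoeff g = 0 := by
  constructor
  · intro h
    have hle : Ideal.span {(MvPowerSeries.X 0 : Rxy), MvPowerSeries.X 1} ≤
        RingHom.ker (MvPowerSeries.constantCoeff (σ := Fin 2) (R := ℂ)) := by
      rw [Ideal.span_le]
      rintro z (rfl | rfl) <;> simp [RingHom.mem_ker]
    exact hle h
  · intro h
    let a : Rxy := fun e => if e 0 = 0 then 0 else MvPowerSeries.coeff e g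
    have ha : ∀ e, MvPowerSeries.coeff e a = if e 0 = 0 then 0 else MvPowerSeries.coeff e g :=
      fun _ => rfl
    have h0 : (MvPowerSeries.X 0 : Rxy) ∣ a := by
      rw [MvPowerSeries.X_dvd_iff]
      intro e he
      rw [ha, if_pos he]
    have h1 : (MvPowerSeries.X 1 : Rxy) ∣ g - a := by
      rw [MvPowerSeries.X_dvd_iff]
      intro e he
      rw [map_sub, ha]
      split_ifs with h0
      · have : e = 0 := by
          ext t
          fin_cases t
          · exact h0
          · exact he
        rw [this, sub_zero]
        exact h
      · simp
    obtain ⟨u, hu⟩ := h0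
    obtain ⟨v, hv⟩ := h1
    rw [Ideal.mem_span_pair]
    refine ⟨u, v, ?_⟩
    have : g = a + (g - a) := by ring
    rw [this, hv, hu]
    ring

/-- Solutions of a second order recursion of the above kind, started at `(p, q)`. -/
noncomputable def march {n : ℕ} (k : ParamSpace n) (idx : ℕ → ℕ) (p q : Rxy) : ℕ → Rxy × Rxy
  | 0 => (p, q)
  | m + 1 => ((march k idx p q m).2,
      -(march k idx p q m).1 -
        PowerSeries.subst (march k idx p q m).2 (derivSeries k (idx m)))

theorem constantCoeff_subst_derivSeries {n : ℕ} (k : ParamSpace n) (i : ℕ) (g : Rxy)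
    (hg : MvPowerSeries.constantCoeff g = 0) :
    MvPowerSeries.constantCoeff (PowerSeries.subst g (derivSeries k i)) = 0 := by
  apply PowerSeries.constantCoeff_subst_eq_zero hg
  rw [← PowerSeries.coeff_zero_eq_constantCoeff_apply]
  simp [derivSeries, par]

theorem constantCoeff_march {n : ℕ} (k : ParamSpace n) (idx : ℕ → ℕ) (p q : Rxy)
    (hp : MvPowerSeries.constantCoeff p = 0) (hq : MvPowerSeries.constantCoeff q = 0) (m : ℕ) :
    MvPowerSeries.constantCoeff (march k idx p q m).1 = 0 ∧
      MvPowerSeries.constantCoeff (march k idx p q m).2 = 0 := by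
  induction m with
  | zero => exact ⟨hp, hq⟩
  | succ m ih =>
    refine ⟨ih.2, ?_⟩
    simp only [march, map_sub, map_neg, ih.1, constantCoeff_subst_derivSeries k _ _ ih.2]
    simp

/-- The system has a solution for every admissible starting position `r`. -/
theorem exists_isSolution {n : ℕ} (k : ParamSpace n) (r : ℕ) :
    ∃ g : ℕ → Rxy, IsSolution k r g := by
  let u := march k (fun m => r + 1 + m) (MvPowerSeries.X 1) (MvPowerSeries.X 0)
  let d := march k (fun m => r - m) (MvPowerSeries.X 0) (MvPowerSeries.X 1)
  have hu := constantCoeff_march k (fun m => r + 1 + m) (MvPowerSeries.X 1)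
    (MvPowerSeries.X 0) (by simp) (by simp)
  have hd := constantCoeff_march k (fun m => r - m) (MvPowerSeries.X 0)
    (MvPowerSeries.X 1) (by simp) (by simp)
  have us : ∀ m, (u (m + 1)).1 = (u m).2 := fun _ => rfl
  have ds : ∀ m, (d (m + 1)).1 = (d m).2 := fun _ => rfl
  let g : ℕ → Rxy := fun i => if r ≤ i then (u (i - r)).1 else (d (r + 1 - i)).1
  have gu : ∀ m, g (r + m) = (u m).1 := fun m => by
    simp [g]
  have gd : ∀ m, m ≤ r + 1 → g (r + 1 - m) = (d m).1 := fun m hm => by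
    simp only [g]
    split_ifs with h
    · obtain rfl | rfl : m = 0 ∨ m = 1 := by omega
      · simp [u, d, march]
      · simp [u, d, march]
    · congr 2; omega
  refine ⟨g, ?_, ?_, ?_, ?_⟩
  · exact gu 0
  · exact gu 1
  · intro i _
    rw [mem_span_iff]
    simp only [g]
    split_ifs
    · exact (hu _).1
    · exact (hd _).1
  · intro i h1 h2
    by_cases hi : r + 1 ≤ i
    · obtain ⟨m, rfl⟩ := Nat.exists_eq_add_of_le hi
      have e0 : g (r + 1 + m - 1) = (u m).1 := by rw [← gu]; congr 1; omega
      have e1 : g (r + 1 + m) = (u m).2 := by rw [← us, ← gu]; congr 1; omega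
      have e2 : g (r + 1 + m + 1) =
          -(u m).1 - PowerSeries.subst (u m).2 (derivSeries k (r + 1 + m)) := by
        have : g (r + 1 + m + 1) = (u (m + 2)).1 := by rw [← gu]; congr 1; omega
        rw [this]; rfl
      rw [e0, e1, e2]; ring
    · obtain ⟨m, hm, rfl⟩ : ∃ m, m < r ∧ i = r - m := ⟨r - i, by omega, by omega⟩
      have e2 : g (r - m + 1) = (d m).1 := by rw [← gd m (by omega)]; congr 1; omega
      have e1 : g (r - m) = (d m).2 := by
        rw [← ds, ← gd (m + 1) (by omega)]; congr 1; omega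
      have e0 : g (r - m - 1) =
          -(d m).1 - PowerSeries.subst (d m).2 (derivSeries k (r - m)) := by
        have : g (r - m - 1) = (d (m + 2)).1 := by
          rw [← gd (m + 2) (by omega)]; congr 1; omega
        rw [this]; rfl
      rw [e0, e1, e2]; ring

/-- The solution is unique in the range of indices `0, …, 2n`. -/
theorem IsSolution.unique {n : ℕ} {k : ParamSpace n} {r : ℕ} {g g' : ℕ → Rxy}
    (hr : r < 2 * n) (h : IsSolution k r g) (h' : IsSolution k r g') (i : ℕ) (hi : i ≤ 2 * n) :
    g i = g' i := by
  have up : ∀ m, r + m + 1 ≤ 2 * n →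
      g (r + m) = g' (r + m) ∧ g (r + m + 1) = g' (r + m + 1) := by
    intro m
    induction m with
    | zero => exact fun _ => ⟨h.base_y.trans h'.base_y.symm, h.base_x.trans h'.base_x.symm⟩
    | succ m ih =>
      intro hm
      obtain ⟨a, b⟩ := ih (by omega)
      refine ⟨b, ?_⟩
      have e := h.eqn (r + m + 1) (by omega) (by omega)
      have e' := h'.eqn (r + m + 1) (by omega) (by omega)
      simp only [Nat.add_sub_cancel] at e e'
      rw [a, b] at e
      exact add_left_cancel (e.trans e'.symm)
  have down : ∀ m, m ≤ r →
      g (r - m) = g' (r - m) ∧ g (r - m + 1) = g' (r - m + 1) := by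
    intro m
    induction m with
    | zero => exact fun _ => ⟨h.base_y.trans h'.base_y.symm, h.base_x.trans h'.base_x.symm⟩
    | succ m ih =>
      intro hm
      obtain ⟨a, b⟩ := ih (by omega)
      have s : r - (m + 1) + 1 = r - m := by omega
      rw [s]
      refine ⟨?_, a⟩
      have e := h.eqn (r - m) (by omega) (by omega)
      have e' := h'.eqn (r - m) (by omega) (by omega)
      have s' : r - m - 1 = r - (m + 1) := by omega
      rw [s'] at e e'
      rw [a, b] at e
      exact add_right_cancel (add_right_cancel (e.trans e'.symm))
  by_cases hri : r + 1 ≤ i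
  · obtain ⟨m, rfl⟩ := Nat.exists_eq_add_of_le hri
    have := (up m (by omega)).2
    rwa [show r + m + 1 = r + 1 + m by omega] at this
  · have := (down (r - i) (by omega)).1
    rwa [show r - (r - i) = i by omega] at this

/-- The solution `g_0, …, g_{2n}` with `g_r = y`, `g_{r+1} = x`. -/
noncomputable def solution {n : ℕ} (k : ParamSpace n) (r : ℕ) : ℕ → Rxy :=
  (exists_isSolution k r).choose

theorem solution_spec {n : ℕ} (k : ParamSpace n) (r : ℕ) : IsSolution k r (solution k r) :=
  (exists_isSolution k r).choose_spec

/-- The generalised Gopakumar--Vafa invariant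
`N_{st}(f) = dim_ℂ ℂ⟦x, y⟧ / (g_{2s-2}, g_{2t})` of a monomialised Type `A` potential `f`,
computed with the starting position `r`; it is `⊤` when the dimension is infinite. -/
noncomputable def gvInvariant {n : ℕ} (r s t : ℕ) (f : Potential n) : ℕ∞ :=
  Cardinal.toENat (Module.rank ℂ
    (Rxy ⧸ Ideal.span {solution (potentialCoeffs f) r (2 * s - 2),
      solution (potentialCoeffs f) r (2 * t)}))

/-- The matrix `A²_{ij}(f(k))`: the successive gluing, along the common diagonal entries, of the
blocks with rows `(2 k_{l2}, 1)` and `(1, 2 k_{l+1,2})` for `i ≤ l < j`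
(and `(2 k_{i2})` if `i = j`). It is the tridiagonal matrix of size `j - i + 1` with diagonal
`2 k_{i2}, …, 2 k_{j2}` and all entries `1` next to the diagonal. -/
noncomputable def matA {n : ℕ} (k : ParamSpace n) (i j : ℕ) :
    Matrix (Fin (j + 1 - i)) (Fin (j + 1 - i)) ℂ :=
  Matrix.of fun a b =>
    if a = b then 2 * par k (i + a.val) 2
    else if a.val + 1 = b.val ∨ b.val + 1 = a.val then 1
    else 0

end TypeA

namespace TypeA

open MvPowerSeries (X)

/-! ### Substitutions in `ℂ⟦x, y⟧` -/

/-! The invariant becomes an order of vanishing in one variable. The recursion runs in both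
directions, so any two consecutive entries determine all `g_i`. Substituting entries of one solution
for `x, y` therefore gives an automorphism of `ℂ⟦x, y⟧` carrying another solution to it
(`IsSolution.transferEquiv`), and the dimension does not depend on `r`.

Starting at `r = 2s - 2` makes one generator equal to `y`, so the quotient is `ℂ⟦x⟧ / (h)` with `h =
g_{2t}(x, 0)`, of dimension `ord h` when `h ≠ 0` (`rank_quotient_X1_pair`). Accordingly `M_i` is the
locus where the coefficients of `h` in degrees below `i` vanish.

The remaining claims are about these coefficients. The recursion makes them polynomials in the
`k_{ij}` (`polynomialCoeffs_lineSol_pair`). The linear one solves a three-term linear recursion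
whose matrix is `matA`, hence vanishes exactly when the determinant does. If `s = t`, a single step
gives `h = -∑ j k_{2s-1,j} x^(j-1)`. Strictness follows from parameters with one non-zero entry, for
which `h` is a non-zero multiple of `x^i`. -/

theorem recursion_unique {R : Type*} [AddCommGroup R] (F : ℕ → R → R) {N r : ℕ} (hr : r < N)
    {u v : ℕ → R}
    (hu : ∀ i, 1 ≤ i → i < N → u (i - 1) + F i (u i) + u (i + 1) = 0)
    (hv : ∀ i, 1 ≤ i → i < N → v (i - 1) + F i (v i) + v (i + 1) = 0)
    (h0 : u r = v r) (h1 : u (r + 1) = v (r + 1)) (i : ℕ) (hi : i ≤ N) : u i = v i := by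
  have up : ∀ m, r + m + 1 ≤ N → u (r + m) = v (r + m) ∧ u (r + m + 1) = v (r + m + 1) := by
    intro m
    induction m with
    | zero => exact fun _ => ⟨h0, h1⟩
    | succ m ih =>
      intro hm
      obtain ⟨a, b⟩ := ih (by omega)
      refine ⟨b, ?_⟩
      have e := hu (r + m + 1) (by omega) (by omega)
      have e' := hv (r + m + 1) (by omega) (by omega)
      simp only [Nat.add_sub_cancel] at e e'
      rw [a, b] at e
      exact add_left_cancel (e.trans e'.symm)
  have down : ∀ m, m ≤ r → u (r - m) = v (r - m) ∧ u (r - m + 1) = v (r - m + 1) := by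
    intro m
    induction m with
    | zero => exact fun _ => ⟨h0, h1⟩
    | succ m ih =>
      intro hm
      obtain ⟨a, b⟩ := ih (by omega)
      have s : r - (m + 1) + 1 = r - m := by omega
      rw [s]
      refine ⟨?_, a⟩
      have e := hu (r - m) (by omega) (by omega)
      have e' := hv (r - m) (by omega) (by omega)
      have s' : r - m - 1 = r - (m + 1) := by omega
      rw [s'] at e e'
      rw [a, b] at e
      exact add_right_cancel (add_right_cancel (e.trans e'.symm))
  by_cases hri : r + 1 ≤ i
  · obtain ⟨m, rfl⟩ := Nat.exists_eq_add_of_le hri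
    have := (up m (by omega)).2
    rwa [show r + m + 1 = r + 1 + m by omega] at this
  · have := (down (r - i) (by omega)).1
    rwa [show r - (r - i) = i by omega] at this

/-- Substitutions commute with the nonlinear term of the recursion, so they carry solutions to
solutions. A general `τ` covers both the endomorphisms of `ℂ⟦x, y⟧` and the restriction to a line.
-/
theorem subst_powerSeries_subst {τ : Type*} {a : Fin 2 → MvPowerSeries τ ℂ}
    (ha : MvPowerSeries.HasSubst a) {g : Rxy} (hg : MvPowerSeries.constantCoeff g = 0)
    (φ : PowerSeries ℂ) :
    MvPowerSeries.subst a (PowerSeries.subst g φ) =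
      PowerSeries.subst (MvPowerSeries.subst a g) φ :=
  MvPowerSeries.subst_comp_subst_apply (PowerSeries.HasSubst.of_constantCoeff_zero hg).const ha φ

theorem hasSubst_pair {τ : Type*} {p q : MvPowerSeries τ ℂ}
    (hp : MvPowerSeries.constantCoeff p = 0) (hq : MvPowerSeries.constantCoeff q = 0) :
    MvPowerSeries.HasSubst ![p, q] :=
  MvPowerSeries.hasSubst_of_constantCoeff_zero fun i => by fin_cases i <;> assumption

theorem IsSolution.constantCoeff {n : ℕ} {k : ParamSpace n} {r : ℕ} {g : ℕ → Rxy}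
    (h : IsSolution k r g) {i : ℕ} (hi : i ≤ 2 * n) : MvPowerSeries.constantCoeff (g i) = 0 :=
  (mem_span_iff _).1 (h.mem i hi)

/-! ### Independence of the starting position -/

theorem IsSolution.hasSubst {n : ℕ} {k : ParamSpace n} {r r' : ℕ} {g : ℕ → Rxy}
    (h : IsSolution k r g) (hr' : r' < 2 * n) : MvPowerSeries.HasSubst ![g (r' + 1), g r'] :=
  hasSubst_pair (h.constantCoeff hr') (h.constantCoeff hr'.le)

/-- The endomorphism of `ℂ⟦x, y⟧` which carries the solution started at `r'` to the solution
started at `r`. -/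
noncomputable def IsSolution.transfer {n : ℕ} {k : ParamSpace n} {r r' : ℕ} {g : ℕ → Rxy}
    (h : IsSolution k r g) (hr' : r' < 2 * n) : Rxy →ₐ[ℂ] Rxy :=
  MvPowerSeries.substAlgHom (h.hasSubst hr')

/-- The transferred sequence solves the same recursion as `g` and agrees with it at `r'` and `r' +
1`, hence everywhere in range. -/
theorem IsSolution.transfer_apply {n : ℕ} {k : ParamSpace n} {r r' : ℕ} {g g' : ℕ → Rxy}
    (h : IsSolution k r g) (hr' : r' < 2 * n) (h' : IsSolution k r' g') (i : ℕ)
    (hi : i ≤ 2 * n) : h.transfer hr' (g' i) = g i := by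
  have key := recursion_unique (fun i z => PowerSeries.subst z (derivSeries k i)) hr'
    (u := fun i => h.transfer hr' (g' i)) (v := g) ?_ h.eqn ?_ ?_ i hi
  · exact key
  · intro i h1 h2
    have e := congrArg (h.transfer hr') (h'.eqn i h1 h2)
    rw [map_add, map_add, map_zero] at e
    rw [← e]
    simp only [IsSolution.transfer, MvPowerSeries.coe_substAlgHom]
    rw [subst_powerSeries_subst (h.hasSubst hr') (h'.constantCoeff h2.le)]
  · simp [IsSolution.transfer, h'.base_y, MvPowerSeries.subst_X (h.hasSubst hr')]
  · simp [IsSolution.transfer, h'.base_x, MvPowerSeries.subst_X (h.hasSubst hr')]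

/-- The composite is a substitution sending `x` to `g (r + 1) = x` and `y` to `g r = y`. -/
theorem IsSolution.transfer_comp {n : ℕ} {k : ParamSpace n} {r r' : ℕ} {g g' : ℕ → Rxy}
    (h : IsSolution k r g) (h' : IsSolution k r' g') (hr : r < 2 * n) (hr' : r' < 2 * n)
    (f : Rxy) : h.transfer hr' (h'.transfer hr f) = f := by
  unfold IsSolution.transfer
  rw [MvPowerSeries.substAlgHom_comp_substAlgHom_apply, MvPowerSeries.substAlgHom_apply]
  simp only [MvPowerSeries.substAlgHom_apply]
  have : (fun s => MvPowerSeries.subst ![g (r' + 1), g r'] (![g' (r + 1), g' r] s)) =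
      (MvPowerSeries.X : Fin 2 → Rxy) := by
    have e := h.transfer_apply hr' h'
    simp only [IsSolution.transfer, MvPowerSeries.substAlgHom_apply] at e
    funext s
    fin_cases s
    · exact (e (r + 1) hr).trans h.base_x
    · exact (e r hr.le).trans h.base_y
  rw [this, MvPowerSeries.subst_self]
  rfl

/-- The automorphism of `ℂ⟦x, y⟧` which carries the solution started at `r'` to the solution
started at `r`. -/
noncomputable def IsSolution.transferEquiv {n : ℕ} {k : ParamSpace n} {r r' : ℕ}
    {g g' : ℕ → Rxy} (h : IsSolution k r g) (h' : IsSolution k r' g') (hr : r < 2 * n)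
    (hr' : r' < 2 * n) : Rxy ≃ₐ[ℂ] Rxy :=
  AlgEquiv.ofAlgHom (h.transfer hr') (h'.transfer hr)
    (AlgHom.ext fun f => h.transfer_comp h' hr hr' f)
    (AlgHom.ext fun f => h'.transfer_comp h hr' hr f)

theorem IsSolution.rank_quotient_eq {n : ℕ} {k : ParamSpace n} {r r' : ℕ} {g g' : ℕ → Rxy}
    (h : IsSolution k r g) (h' : IsSolution k r' g') (hr : r < 2 * n) (hr' : r' < 2 * n)
    {a b : ℕ} (ha : a ≤ 2 * n) (hb : b ≤ 2 * n) :
    Module.rank ℂ (Rxy ⧸ Ideal.span {g a, g b}) =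
      Module.rank ℂ (Rxy ⧸ Ideal.span {g' a, g' b}) := by
  refine (Ideal.quotientEquivAlg _ _ (h.transferEquiv h' hr hr') ?_).toLinearEquiv.rank_eq.symm
  rw [Ideal.map_span, Set.image_pair]
  congr 2
  · exact (h.transfer_apply hr' h' a ha).symm
  · exact congrArg _ (h.transfer_apply hr' h' b hb).symm

/-! ### Restriction to the line `y = 0` -/

theorem hasSubst_line :
    MvPowerSeries.HasSubst (![PowerSeries.X, 0] : Fin 2 → MvPowerSeries Unit ℂ) :=
  hasSubst_pair PowerSeries.constantCoeff_X (map_zero _)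

/-- The map `ℂ⟦x, y⟧ → ℂ⟦x⟧` which sets `y = 0`. -/
noncomputable def restrictLine : Rxy →ₐ[ℂ] PowerSeries ℂ :=
  MvPowerSeries.substAlgHom hasSubst_line

theorem restrictLine_X0 : restrictLine (X 0) = PowerSeries.X := by
  simp [restrictLine, MvPowerSeries.subst_X hasSubst_line]

theorem restrictLine_X1 : restrictLine (X 1) = 0 := by
  simp [restrictLine, MvPowerSeries.subst_X hasSubst_line]

theorem restrictLine_subst {g : Rxy} (hg : MvPowerSeries.constantCoeff g = 0)
    (φ : PowerSeries ℂ) :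
    restrictLine (PowerSeries.subst g φ) = PowerSeries.subst (restrictLine g) φ := by
  simp only [restrictLine, MvPowerSeries.coe_substAlgHom]
  exact subst_powerSeries_subst hasSubst_line hg φ

theorem restrictLine_subst_X0 (φ : PowerSeries ℂ) :
    restrictLine (PowerSeries.subst (X 0 : Rxy) φ) = φ := by
  rw [restrictLine_subst (by simp), restrictLine_X0, PowerSeries.X_subst]

/-- Collecting the monomials free of `y` gives `f = p(x) + y b`; restriction to the line returns
`p`, which must be zero. -/
theorem X1_dvd_of_restrictLine_eq_zero {f : Rxy} (hf : restrictLine f = 0) :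
    (X 1 : Rxy) ∣ f := by
  let p : PowerSeries ℂ := PowerSeries.mk fun m => MvPowerSeries.coeff (Finsupp.single 0 m) f
  have hd : (X 1 : Rxy) ∣ f - PowerSeries.subst (X 0 : Rxy) p := by
    rw [MvPowerSeries.X_dvd_iff]
    intro e he
    have : e = Finsupp.single 0 (e 0) := by
      ext t
      fin_cases t
      · simp
      · simpa using he
    rw [map_sub, PowerSeries.coeff_subst_single, if_pos this, PowerSeries.coeff_mk, ← this,
      sub_self]
  obtain ⟨b, hb⟩ := hd
  have hp : p = 0 := by
    have := congrArg restrictLine hb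
    rwa [map_sub, map_mul, restrictLine_X1, zero_mul, hf, restrictLine_subst_X0, zero_sub,
      neg_eq_zero] at this
  refine ⟨b, ?_⟩
  rw [← hb, hp, ← PowerSeries.coe_substAlgHom (PowerSeries.HasSubst.X 0), map_zero, sub_zero]

/-- The first `N` coefficients of a power series restricted to the line `y = 0`. -/
noncomputable def lineCoeffs (N : ℕ) : Rxy →ₗ[ℂ] (Fin N → ℂ) :=
  LinearMap.pi fun j => (PowerSeries.coeff (R := ℂ) j.val).comp restrictLine.toLinearMap

theorem lineCoeffs_surjective (N : ℕ) : Function.Surjective (lineCoeffs N) := by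
  intro v
  refine ⟨PowerSeries.subst (X 0 : Rxy)
    (PowerSeries.mk fun m => if h : m < N then v ⟨m, h⟩ else 0), ?_⟩
  funext j
  simp [lineCoeffs, restrictLine_subst_X0]

theorem mem_ker_lineCoeffs {N : ℕ} {f : Rxy} :
    f ∈ LinearMap.ker (lineCoeffs N) ↔ PowerSeries.X ^ N ∣ restrictLine f := by
  rw [PowerSeries.X_pow_dvd_iff, LinearMap.mem_ker, funext_iff]
  exact ⟨fun h m hm => h ⟨m, hm⟩, fun h j => h j.val j.2⟩

theorem exists_mul_eq_X_pow {N : ℕ} {h : PowerSeries ℂ}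
    (h0 : ∀ m < N, PowerSeries.coeff m h = 0) (hN : PowerSeries.coeff N h ≠ 0) :
    ∃ w, h * w = PowerSeries.X ^ N := by
  obtain ⟨u, rfl⟩ := PowerSeries.X_pow_dvd_iff.2 h0
  have hu : PowerSeries.constantCoeff u ≠ 0 := by
    rw [← PowerSeries.coeff_zero_eq_constantCoeff_apply]
    simpa [PowerSeries.coeff_X_pow_mul'] using hN
  exact ⟨u⁻¹, by rw [mul_assoc, PowerSeries.mul_inv_cancel _ hu, mul_one]⟩

/-- Modulo `y`, the series `g` is a unit times `x^N`, so the ideal is exactly the kernel of the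
surjection `lineCoeffs N` onto `ℂ^N`. -/
theorem rank_quotient_X1_pair {N : ℕ} {g : Rxy}
    (h0 : ∀ m < N, PowerSeries.coeff m (restrictLine g) = 0)
    (hN : PowerSeries.coeff N (restrictLine g) ≠ 0) :
    Module.rank ℂ (Rxy ⧸ Ideal.span {(X 1 : Rxy), g}) = N := by
  have hker : LinearMap.ker (lineCoeffs N) =
      (Ideal.span {(X 1 : Rxy), g}).restrictScalars ℂ := by
    ext f
    rw [mem_ker_lineCoeffs, Submodule.restrictScalars_mem, Ideal.mem_span_pair]
    constructor
    · rintro ⟨q, hq⟩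
      obtain ⟨w, hw⟩ := exists_mul_eq_X_pow h0 hN
      -- Subtract the multiple of `g` that agrees with `f` on the line; the remainder is divisible
      -- by `y`.
      obtain ⟨b, hb⟩ := X1_dvd_of_restrictLine_eq_zero
        (f := f - g * PowerSeries.subst (X 0 : Rxy) (w * q)) (by
          rw [map_sub, map_mul, restrictLine_subst_X0, hq, ← mul_assoc, hw, sub_self])
      exact ⟨b, PowerSeries.subst (X 0 : Rxy) (w * q), by linear_combination -hb⟩
    · rintro ⟨a, b, rfl⟩
      rw [map_add, map_mul, map_mul, restrictLine_X1, mul_zero, zero_add]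
      exact (PowerSeries.X_pow_dvd_iff.2 h0).mul_left _
  have e := (Submodule.Quotient.restrictScalarsEquiv ℂ
    (Ideal.span {(X 1 : Rxy), g})).symm.rank_eq
  rw [e, ← hker, ((lineCoeffs N).quotKerEquivOfSurjective (lineCoeffs_surjective N)).rank_eq]
  simp

/-! ### The one-variable recursion -/

/-- The restriction to `y = 0` of the solution `g` with `g_{2s-2} = y` and `g_{2s-1} = x`. -/
noncomputable def lineSol {n : ℕ} (s : ℕ) (k : ParamSpace n) (i : ℕ) : PowerSeries ℂ :=
  restrictLine (solution k (2 * s - 2) i)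

/-- Independence of `r` allows moving to the start `2s - 2`, where the first generator is `y`. -/
theorem gvInvariant_potential {n s t r i : ℕ} (hs : 1 ≤ s) (hst : s ≤ t) (htn : t ≤ n)
    (hr : r < 2 * n) (k : ParamSpace n)
    (h0 : ∀ m < i, PowerSeries.coeff m (lineSol s k (2 * t)) = 0)
    (hi : PowerSeries.coeff i (lineSol s k (2 * t)) ≠ 0) :
    gvInvariant r s t (potential n k) = i := by
  have hsol := solution_spec k (2 * s - 2)
  rw [gvInvariant, potentialCoeffs_potential,
    (solution_spec k r).rank_quotient_eq hsol hr (by omega) (by omega) (by omega), hsol.base_y,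
    rank_quotient_X1_pair h0 hi]
  simp

section lineSol

variable {n s : ℕ} (k : ParamSpace n)

theorem lineSol_start : lineSol s k (2 * s - 2) = 0 := by
  rw [lineSol, (solution_spec k _).base_y, restrictLine_X1]

theorem lineSol_next (hs : 1 ≤ s) : lineSol s k (2 * s - 1) = PowerSeries.X := by
  rw [lineSol, show 2 * s - 1 = 2 * s - 2 + 1 by omega, (solution_spec k _).base_x,
    restrictLine_X0]

theorem lineSol_rec {i : ℕ} (hi : i + 1 < 2 * n) :
    lineSol s k (i + 2) =
      -lineSol s k i - PowerSeries.subst (lineSol s k (i + 1)) (derivSeries k (i + 1)) := by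
  have hsol := solution_spec k (2 * s - 2)
  have e := congrArg restrictLine (hsol.eqn (i + 1) (by omega) hi)
  rw [map_add, map_add, restrictLine_subst (hsol.constantCoeff hi.le), map_zero,
    Nat.add_sub_cancel] at e
  unfold lineSol
  linear_combination e

theorem coeff_zero_derivSeries (i : ℕ) : PowerSeries.coeff 0 (derivSeries k i) = 0 := by
  simp [derivSeries, par]

theorem constantCoeff_derivSeries (i : ℕ) :
    PowerSeries.constantCoeff (derivSeries k i) = 0 := by
  rw [← PowerSeries.coeff_zero_eq_constantCoeff_apply, coeff_zero_derivSeries]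

theorem constantCoeff_subst_eq_zero {h φ : PowerSeries ℂ}
    (hh : PowerSeries.constantCoeff h = 0) (hφ : PowerSeries.constantCoeff φ = 0) :
    PowerSeries.constantCoeff (PowerSeries.subst h φ) = 0 :=
  PowerSeries.constantCoeff_subst_eq_zero hh φ hφ

theorem constantCoeff_lineSol_pair (hs : 1 ≤ s) (m : ℕ) (hm : 2 * s - 2 + m + 1 ≤ 2 * n) :
    PowerSeries.constantCoeff (lineSol s k (2 * s - 2 + m)) = 0 ∧
      PowerSeries.constantCoeff (lineSol s k (2 * s - 2 + m + 1)) = 0 := by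
  induction m with
  | zero =>
    rw [add_zero, lineSol_start, show 2 * s - 2 + 1 = 2 * s - 1 by omega, lineSol_next k hs]
    simp
  | succ m ih =>
    obtain ⟨a, b⟩ := ih (by omega)
    refine ⟨b, ?_⟩
    rw [show 2 * s - 2 + (m + 1) + 1 = 2 * s - 2 + m + 2 by omega, lineSol_rec k (by omega),
      map_sub, map_neg, a, constantCoeff_subst_eq_zero b (constantCoeff_derivSeries k _)]
    simp

/-- Since `X^d` divides `h^d`, terms with `d > m` do not contribute. This finiteness is what keeps
the coefficients of a substitution polynomial in the parameters. -/
theorem coeff_subst_eq_sum {h φ : PowerSeries ℂ} (hh : PowerSeries.constantCoeff h = 0)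
    (m : ℕ) : PowerSeries.coeff m (PowerSeries.subst h φ) =
      ∑ d ∈ Finset.range (m + 1), PowerSeries.coeff d φ * PowerSeries.coeff m (h ^ d) := by
  rw [PowerSeries.coeff_subst' (.of_constantCoeff_zero' hh)]
  refine finsum_eq_sum_of_support_subset _ fun d hd => ?_
  by_contra hlt
  have hlt : m < d := by simpa using hlt
  refine hd ?_
  have : PowerSeries.X ^ d ∣ h ^ d := pow_dvd_pow_of_dvd (PowerSeries.X_dvd_iff.2 hh) d
  simp [PowerSeries.X_pow_dvd_iff.1 this m hlt]

/-! ### The coefficients are polynomials in the parameters -/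

/-- The coefficients of a power series depending on parameters are polynomials in them. -/
def PolynomialCoeffs {σ : Type*} (F : (σ → ℂ) → PowerSeries ℂ) : Prop :=
  ∀ m, ∃ P : MvPolynomial σ ℂ, ∀ k, PowerSeries.coeff m (F k) = MvPolynomial.eval k P

namespace PolynomialCoeffs

variable {σ : Type*} {F G : (σ → ℂ) → PowerSeries ℂ}

theorem const (f : PowerSeries ℂ) : PolynomialCoeffs fun _ : σ → ℂ => f :=
  fun m => ⟨MvPolynomial.C (PowerSeries.coeff m f), fun _ => by simp⟩

theorem neg (hF : PolynomialCoeffs F) : PolynomialCoeffs fun k => -F k := fun m => by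
  obtain ⟨P, hP⟩ := hF m
  exact ⟨-P, fun k => by simp [hP]⟩

theorem sub (hF : PolynomialCoeffs F) (hG : PolynomialCoeffs G) :
    PolynomialCoeffs fun k => F k - G k := fun m => by
  obtain ⟨P, hP⟩ := hF m
  obtain ⟨Q, hQ⟩ := hG m
  exact ⟨P - Q, fun k => by simp [hP, hQ]⟩

theorem mul (hF : PolynomialCoeffs F) (hG : PolynomialCoeffs G) :
    PolynomialCoeffs fun k => F k * G k := fun m => by
  choose P hP using hF
  choose Q hQ using hG
  exact ⟨∑ p ∈ Finset.HasAntidiagonal.antidiagonal m, P p.1 * Q p.2, fun k => by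
    simp [PowerSeries.coeff_mul, hP, hQ]⟩

theorem pow (hF : PolynomialCoeffs F) (d : ℕ) : PolynomialCoeffs fun k => F k ^ d := by
  induction d with
  | zero => simpa using const 1
  | succ d ih => simpa only [pow_succ] using ih.mul hF

theorem subst (hF : PolynomialCoeffs F) (hG : PolynomialCoeffs G)
    (h0 : ∀ k, PowerSeries.constantCoeff (F k) = 0) :
    PolynomialCoeffs fun k => PowerSeries.subst (F k) (G k) := fun m => by
  choose Q hQ using hG
  choose P hP using fun d => hF.pow d m
  exact ⟨∑ d ∈ Finset.range (m + 1), Q d * P d, fun k => by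
    simp [coeff_subst_eq_sum (h0 k), hP, hQ]⟩

end PolynomialCoeffs

theorem polynomialCoeffs_derivSeries (i : ℕ) :
    PolynomialCoeffs fun k : ParamSpace n => derivSeries k i := fun m => by
  by_cases h : 1 ≤ i ∧ i < 2 * n ∧ 2 ≤ m + 1
  · exact ⟨MvPolynomial.C ((m : ℂ) + 1) * MvPolynomial.X ⟨(i, m + 1), h⟩, fun k => by
      simp only [derivSeries, PowerSeries.coeff_mk, par, dif_pos h, map_mul, MvPolynomial.eval_C,
        MvPolynomial.eval_X]⟩
  · exact ⟨0, fun k => by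
      simp only [derivSeries, PowerSeries.coeff_mk, par, dif_neg h, mul_zero, map_zero]⟩

theorem polynomialCoeffs_lineSol_pair (hs : 1 ≤ s) (m : ℕ) (hm : 2 * s - 2 + m + 1 ≤ 2 * n) :
    PolynomialCoeffs (fun k : ParamSpace n => lineSol s k (2 * s - 2 + m)) ∧
      PolynomialCoeffs fun k : ParamSpace n => lineSol s k (2 * s - 2 + m + 1) := by
  induction m with
  | zero =>
    simp only [add_zero, lineSol_start, show 2 * s - 2 + 1 = 2 * s - 1 by omega,
      lineSol_next _ hs]
    exact ⟨.const _, .const _⟩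
  | succ m ih =>
    obtain ⟨a, b⟩ := ih (by omega)
    refine ⟨b, ?_⟩
    simp only [show 2 * s - 2 + (m + 1) + 1 = 2 * s - 2 + m + 2 by omega,
      lineSol_rec _ (show 2 * s - 2 + m + 1 < 2 * n by omega)]
    exact a.neg.sub (b.subst (polynomialCoeffs_derivSeries _) fun k =>
      (constantCoeff_lineSol_pair k hs m (by omega)).2)

/-! ### Linear terms and the tridiagonal determinant -/

theorem coeff_one_subst {h φ : PowerSeries ℂ} (hh : PowerSeries.constantCoeff h = 0) :
    PowerSeries.coeff 1 (PowerSeries.subst h φ) =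
      PowerSeries.coeff 1 φ * PowerSeries.coeff 1 h := by
  simp [coeff_subst_eq_sum hh, Finset.sum_range_succ, PowerSeries.coeff_one]

/-- Only the `j = 2` term of the derivative series contributes in degree one, so the recursion
linearises to the rows of the tridiagonal matrix. -/
theorem coeff_one_lineSol_rec (hs : 1 ≤ s) (m : ℕ) (hm : 2 * s - 2 + m + 2 ≤ 2 * n) :
    PowerSeries.coeff 1 (lineSol s k (2 * s - 2 + m)) +
      2 * par k (2 * s - 1 + m) 2 * PowerSeries.coeff 1 (lineSol s k (2 * s - 2 + (m + 1))) +
      PowerSeries.coeff 1 (lineSol s k (2 * s - 2 + (m + 2))) = 0 := by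
  rw [show 2 * s - 2 + (m + 2) = 2 * s - 2 + m + 2 by omega, lineSol_rec k (by omega), map_sub,
    map_neg, coeff_one_subst (constantCoeff_lineSol_pair k hs m (by omega)).2, derivSeries,
    PowerSeries.coeff_mk, show 2 * s - 1 + m = 2 * s - 2 + m + 1 by omega]
  norm_num
  ring_nf

/-- The vector has entries `w 1, …, w N`, with `N` the size of the matrix; the zero boundary values
`w 0` and `w (N + 1)` let the first and last rows take the same form as the interior ones. -/
theorem matA_mulVec {i j : ℕ} (w : ℕ → ℂ) (h0 : w 0 = 0) (hN : w (j + 1 - i + 1) = 0)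
    (a : Fin (j + 1 - i)) :
    (matA k i j).mulVec (fun b => w (b.val + 1)) a =
      w a.val + 2 * par k (i + a.val) 2 * w (a.val + 1) + w (a.val + 2) := by
  have hsplit : ∀ b : Fin (j + 1 - i), matA k i j a b * w (b.val + 1) =
      (if a.val = b.val then 2 * par k (i + a.val) 2 * w (b.val + 1) else 0) +
      (if a.val + 1 = b.val then w (b.val + 1) else 0) +
      (if b.val + 1 = a.val then w (b.val + 1) else 0) := by
    intro b
    simp only [matA, Matrix.of_apply, Fin.ext_iff]
    split_ifs <;> first | omega | simp
  have ha := a.2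
  rw [Matrix.mulVec, dotProduct, Finset.sum_congr rfl fun b _ => hsplit b,
    Fin.sum_univ_eq_sum_range (fun b =>
      (if a.val = b then 2 * par k (i + a.val) 2 * w (b + 1) else 0) +
      (if a.val + 1 = b then w (b + 1) else 0) + (if b + 1 = a.val then w (b + 1) else 0)) (j + 1 - i),
    Finset.sum_add_distrib, Finset.sum_add_distrib, Finset.sum_ite_eq, Finset.sum_ite_eq,
    if_pos (Finset.mem_range.2 ha)]
  have h1 : (if a.val + 1 ∈ Finset.range (j + 1 - i) then w (a.val + 1 + 1) else 0) = w (a.val + 2) := by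
    split_ifs with h
    · rfl
    · rw [Finset.mem_range] at h
      rw [show a.val + 2 = j + 1 - i + 1 by omega, hN]
  have h2 : (∑ b ∈ Finset.range (j + 1 - i), if b + 1 = a.val then w (b + 1) else 0) = w a.val := by
    rcases Nat.eq_zero_or_pos a.val with h | h
    · rw [h, h0]
      exact Finset.sum_eq_zero fun b _ => if_neg (by omega)
    · rw [Finset.sum_eq_single_of_mem (a.val - 1) (Finset.mem_range.2 (by omega))
        fun b _ hb => if_neg (by omega), if_pos (by omega), Nat.sub_add_cancel h]
  rw [h1, h2]
  ring

/-- Kernel vectors are the solutions of the recursion that vanish at both ends. Those vanishing at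
the left end are multiples of `c`, so a non-zero one exists exactly when `c` also vanishes at the
right end. -/
theorem det_matA_eq_zero_iff {i j : ℕ} (hij : i ≤ j) (c : ℕ → ℂ) (c0 : c 0 = 0) (c1 : c 1 = 1)
    (hc : ∀ m < j + 1 - i, c m + 2 * par k (i + m) 2 * c (m + 1) + c (m + 2) = 0) :
    (matA k i j).det = 0 ↔ c (j + 1 - i + 1) = 0 := by
  rw [← Matrix.exists_mulVec_eq_zero_iff]
  constructor
  · rintro ⟨v, hv, hAv⟩
    -- The kernel vector, shifted by one and extended by zero at both ends.
    let w : ℕ → ℂ := fun m => if h : 1 ≤ m ∧ m - 1 < j + 1 - i then v ⟨m - 1, h.2⟩ else 0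
    have hw0 : w 0 = 0 := dif_neg (by omega)
    have hwN : w (j + 1 - i + 1) = 0 := dif_neg (by omega)
    have hwv : (fun b : Fin (j + 1 - i) => w (b.val + 1)) = v := by
      funext b
      simp [w, b.2]
    have hrec : ∀ m < j + 1 - i, w m + 2 * par k (i + m) 2 * w (m + 1) + w (m + 2) = 0 := by
      intro m hm
      have := matA_mulVec k w hw0 hwN ⟨m, hm⟩
      rw [hwv, hAv] at this
      exact this.symm
    have hwc : ∀ m, m ≤ j + 1 - i → w m = w 1 * c m ∧ w (m + 1) = w 1 * c (m + 1) := by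
      intro m
      induction m with
      | zero => simp [hw0, c0, c1]
      | succ m ih =>
        intro hm
        obtain ⟨a, b⟩ := ih (by omega)
        refine ⟨b, ?_⟩
        have e1 := hrec m (by omega)
        have e2 := hc m (by omega)
        rw [a, b] at e1
        linear_combination e1 - w 1 * e2
    have hw1 : w 1 ≠ 0 := by
      intro h
      refine hv (hwv ▸ funext fun b => ?_)
      rw [(hwc b b.2.le).2, h, zero_mul]
      rfl
    have := (hwc _ le_rfl).2
    rw [hwN] at this
    exact (mul_eq_zero.1 this.symm).resolve_left hw1
  · intro hN
    refine ⟨fun b => c (b.val + 1), fun h => ?_, funext fun a => ?_⟩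
    · have := congrFun h ⟨0, by omega⟩
      simp [c1] at this
    · rw [matA_mulVec k c c0 hN a, hc a a.2]
      rfl

theorem coeff_one_lineSol_eq_zero_iff {t : ℕ} (hs : 1 ≤ s) (hst : s ≤ t) (htn : t ≤ n) :
    PowerSeries.coeff 1 (lineSol s k (2 * t)) = 0 ↔
      (matA k (2 * s - 1) (2 * t - 1)).det = 0 := by
  rw [det_matA_eq_zero_iff k (by omega)
    (fun m => PowerSeries.coeff 1 (lineSol s k (2 * s - 2 + m))) (by simp [lineSol_start])
    (by simp [show 2 * s - 2 + 1 = 2 * s - 1 by omega, lineSol_next k hs])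
    (fun m hm => coeff_one_lineSol_rec k hs m (by omega))]
  rw [show 2 * s - 2 + (2 * t - 1 + 1 - (2 * s - 1) + 1) = 2 * t by omega]

/-! ### The diagonal case -/

theorem lineSol_two_mul (hs : 1 ≤ s) (hsn : s ≤ n) :
    lineSol s k (2 * s) = -derivSeries k (2 * s - 1) := by
  have h := lineSol_rec (s := s) k (i := 2 * s - 2) (by omega)
  rwa [show 2 * s - 2 + 2 = 2 * s by omega, show 2 * s - 2 + 1 = 2 * s - 1 by omega,
    lineSol_start, lineSol_next k hs, PowerSeries.X_subst, neg_zero, zero_sub] at h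

end lineSol

/-! ### Parameters with a prescribed invariant -/

/-- The parameters whose only non-zero entry is `k_{lj} = 1`. -/
def singleParam (n l j : ℕ) : ParamSpace n := fun p => if p.1 = (l, j) then 1 else 0

theorem derivSeries_singleParam_of_ne {n l j i : ℕ} (h : i ≠ l) :
    derivSeries (singleParam n l j) i = 0 := by
  ext m
  simp [derivSeries, par, singleParam, h]

theorem derivSeries_singleParam_self {n l i : ℕ} (h1 : 1 ≤ l) (h2 : l < 2 * n) (hi : 1 ≤ i) :
    derivSeries (singleParam n l (i + 1)) l = PowerSeries.C ((i : ℂ) + 1) * PowerSeries.X ^ i := by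
  ext m
  rw [PowerSeries.coeff_C_mul, PowerSeries.coeff_X_pow, derivSeries, PowerSeries.coeff_mk, par]
  by_cases hm : m = i
  · subst hm
    rw [dif_pos ⟨h1, h2, by omega⟩]
    simp [singleParam]
  · simp [singleParam, hm]

/-- Before index `2t - 1` is reached every derivative series is zero, so each step of two only
changes the sign. -/
theorem lineSol_singleParam_pair {n s t i : ℕ} (hs : 1 ≤ s) (htn : t ≤ n) (m : ℕ)
    (hm : s + m ≤ t) :
    lineSol s (singleParam n (2 * t - 1) (i + 1)) (2 * s - 2 + 2 * m) = 0 ∧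
      lineSol s (singleParam n (2 * t - 1) (i + 1)) (2 * s - 2 + 2 * m + 1) =
        (-1) ^ m * PowerSeries.X := by
  set k := singleParam n (2 * t - 1) (i + 1) with hk
  induction m with
  | zero =>
    rw [mul_zero, add_zero, lineSol_start, show 2 * s - 2 + 1 = 2 * s - 1 by omega,
      lineSol_next k hs]
    simp
  | succ m ih =>
    obtain ⟨a, b⟩ := ih (by omega)
    have step : ∀ l, l + 1 < 2 * t - 1 →
        PowerSeries.constantCoeff (lineSol s k (l + 1)) = 0 →
        lineSol s k (l + 2) = -lineSol s k l := by
      intro l hl h0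
      rw [lineSol_rec k (by omega), hk, derivSeries_singleParam_of_ne (by omega),
        ← PowerSeries.coe_substAlgHom (PowerSeries.HasSubst.of_constantCoeff_zero' h0), map_zero,
        sub_zero]
    have a' : lineSol s k (2 * s - 2 + 2 * (m + 1)) = 0 := by
      rw [show 2 * s - 2 + 2 * (m + 1) = 2 * s - 2 + 2 * m + 2 by omega,
        step _ (by omega) (by rw [b]; simp), a, neg_zero]
    refine ⟨a', ?_⟩
    rw [show 2 * s - 2 + 2 * (m + 1) + 1 = 2 * s - 2 + 2 * m + 1 + 2 by omega,
      step _ (by omega) ?_, b]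
    · ring
    · rw [show 2 * s - 2 + 2 * m + 1 + 1 = 2 * s - 2 + 2 * (m + 1) by omega, a', map_zero]

/-- The only non-zero derivative series, `(i + 1) z^i`, enters in the last step, evaluated at `z =
±x`. The order of vanishing is thus exactly `i`. -/
theorem lineSol_singleParam {n s t i : ℕ} (hs : 1 ≤ s) (hst : s ≤ t) (htn : t ≤ n)
    (hi : 1 ≤ i) :
    lineSol s (singleParam n (2 * t - 1) (i + 1)) (2 * t) =
      PowerSeries.C (-((i : ℂ) + 1) * ((-1) ^ (t - s)) ^ i) * PowerSeries.X ^ i := by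
  obtain ⟨a, b⟩ := lineSol_singleParam_pair (i := i) hs htn (t - s) (by omega)
  rw [show 2 * s - 2 + 2 * (t - s) = 2 * t - 2 by omega] at a b
  rw [show 2 * t = 2 * t - 2 + 2 by omega, lineSol_rec _ (by omega),
    show 2 * t - 2 + 2 = 2 * t by omega, a, b, show 2 * t - 2 + 1 = 2 * t - 1 by omega,
    derivSeries_singleParam_self (by omega) (by omega) hi]
  have hX : PowerSeries.HasSubst ((-1) ^ (t - s) * PowerSeries.X : PowerSeries ℂ) :=
    PowerSeries.HasSubst.of_constantCoeff_zero' (by simp)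
  rw [PowerSeries.subst_mul hX, PowerSeries.subst_pow hX, PowerSeries.subst_X hX]
  have hC : PowerSeries.subst ((-1) ^ (t - s) * PowerSeries.X : PowerSeries ℂ)
      (PowerSeries.C ((i : ℂ) + 1)) = PowerSeries.C ((i : ℂ) + 1) := PowerSeries.subst_C _
  rw [hC, mul_pow]
  simp only [map_mul, map_neg, map_pow, map_one]
  ring

end TypeA

/-! ### The filtration by order of vanishing on the line -/

theorem mainTheorem6 (n s t : ℕ) (hs : 1 ≤ s) (hst : s ≤ t) (htn : t ≤ n) :
    ∃ M : ℕ → Set (TypeA.ParamSpace n),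
      -- a strictly decreasing filtration `M 1 ⊋ M 2 ⊋ …` of the whole parameter space
      M 1 = Set.univ ∧
      (∀ i : ℕ, 1 ≤ i → M (i + 1) ⊂ M i) ∧
      -- the invariant is `i` on `M i \ M (i + 1)`, for every starting position `r`
      (∀ i : ℕ, 1 ≤ i → ∀ k ∈ M i \ M (i + 1), ∀ r : ℕ, r < 2 * n →
        TypeA.gvInvariant r s t (TypeA.potential n k) = (i : ℕ∞)) ∧
      -- each `M i` is the common zero locus of finitely many polynomials in the coordinates
      (∀ i : ℕ, 1 ≤ i → ∃ S : Finset (MvPolynomial (TypeA.ParamIndex n) ℂ),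
        M i = {k | ∀ P ∈ S, MvPolynomial.eval k P = 0}) ∧
      M 2 = {k | (TypeA.matA k (2 * s - 1) (2 * t - 1)).det = 0} ∧
      -- the explicit description of the filtration when `s = t`
      (s = t → ∀ i : ℕ, 2 ≤ i →
        M i = {k | ∀ j : ℕ, 2 ≤ j → j ≤ i → TypeA.par k (2 * s - 1) j = 0}) := by
  -- The offset is chosen so that the second member of the pair has index `2t`.
  have hpoly := (TypeA.polynomialCoeffs_lineSol_pair (n := n) hs (2 * t - 2 * s + 1)
    (by omega)).2
  rw [show 2 * s - 2 + (2 * t - 2 * s + 1) + 1 = 2 * t by omega] at hpoly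
  -- The constant term always vanishes: hence `M 1` is everything and `M 2` is cut out by the linear
  -- coefficient alone.
  have hzero : ∀ k : TypeA.ParamSpace n,
      PowerSeries.coeff 0 (TypeA.lineSol s k (2 * t)) = 0 := fun k => by
    have h := (TypeA.constantCoeff_lineSol_pair k hs (2 * t - 2 * s + 1) (by omega)).2
    rw [show 2 * s - 2 + (2 * t - 2 * s + 1) + 1 = 2 * t by omega] at h
    rwa [PowerSeries.coeff_zero_eq_constantCoeff_apply]
  refine ⟨fun i => {k | ∀ m < i, PowerSeries.coeff m (TypeA.lineSol s k (2 * t)) = 0},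
    ?_, ?_, ?_, ?_, ?_, ?_⟩
  · refine Set.eq_univ_of_forall fun k m hm => ?_
    rw [Nat.lt_one_iff.1 hm]
    exact hzero k
  · intro i hi
    -- The witness has order of vanishing exactly `i`, as `k_{2t-1,i+1}` contributes in degree `i`.
    refine (Set.ssubset_iff_of_subset ?_).2 ⟨TypeA.singleParam n (2 * t - 1) (i + 1), fun m hm => ?_, fun h => ?_⟩
    · exact fun k hk m hm => hk m (Nat.lt_succ_of_lt hm)
    · rw [TypeA.lineSol_singleParam hs hst htn hi, PowerSeries.coeff_C_mul,
        PowerSeries.coeff_X_pow, if_neg hm.ne, mul_zero]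
    · have e := h i (Nat.lt_succ_self i)
      rw [TypeA.lineSol_singleParam hs hst htn hi, PowerSeries.coeff_C_mul,
        PowerSeries.coeff_X_pow, if_pos rfl, mul_one] at e
      exact mul_ne_zero (neg_ne_zero.2 (Nat.cast_add_one_ne_zero i)) (by simp) e
  · rintro i - k ⟨hk, hk'⟩ r hr
    refine TypeA.gvInvariant_potential hs hst htn hr k hk fun h => hk' fun m hm => ?_
    rcases Nat.lt_succ_iff_lt_or_eq.1 hm with h' | rfl
    · exact hk m h'
    · exact h
  · intro i _
    classical
    choose P hP using hpoly
    -- `P m` computes the coefficient of degree `m`, so the `i` polynomials of degrees below `i`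
    -- suffice.
    refine ⟨(Finset.range i).image P, Set.ext fun k => ?_⟩
    simp [hP]
  · ext k
    rw [Set.mem_ofPred_eq, Set.mem_ofPred_eq, ← TypeA.coeff_one_lineSol_eq_zero_iff k hs hst htn]
    refine ⟨fun h => h 1 one_lt_two, fun h m hm => ?_⟩
    interval_cases m
    · exact hzero k
    · exact h
  · rintro rfl i -
    ext k
    simp only [Set.mem_ofPred_eq, TypeA.lineSol_two_mul k hs htn, map_neg, neg_eq_zero,
      TypeA.derivSeries, PowerSeries.coeff_mk]
    constructor
    -- The parameter `k_{2s-1,j}` sits in degree `j - 1`, with the non-zero factor `j`.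
    · intro h j h2 hj
      have e := h (j - 1) (by omega)
      rw [Nat.sub_add_cancel (by omega)] at e
      exact (mul_eq_zero.1 e).resolve_left (Nat.cast_add_one_ne_zero _)
    · intro h m hm
      rcases Nat.eq_zero_or_pos m with rfl | hm0
      -- Degree zero would correspond to `j = 1`, where `par` takes its default value `0`.
      · simp [TypeA.par]
      · rw [h (m + 1) (by omega) (by omega), mul_zero]
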